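/- **Setting.** Let $\mathcal M\subset\mathbb R^F$ be a compact $d$-dimensional smooth embedded submanifold without boundary, with uniform probability measure $\mu$ (normalized volume) and Laplace–Beltrami operator $\mathcal L=-\mathrm{div}\,\nabla$. Let $\mathcal X:\mathcal M\to\mathbb R^{w_0}$ be continuous (for example the inclusion) and let $\mathcal Y:\mathcal M\to\mathbb R^{w_L}$ be measurable labels. Let $\rho:\mathbb R\to\mathbb R$ be differentiable with $\rho(0)=0$ and $\rho,\rho'$ 1-Lipschitz. Let $\tilde l(y,y')\ge 0$ be a measurable loss that is differentiable in $y'$, with $\tilde l(y,\cdot)$ and its gradient 1-Lipschitz for each $y$, and with $\tilde l(\mathcal Y,0)$ integrable on $\mathcal M$. For weights $\mathcal W=\{W_{\ell k}\}$, $W_{\ell k}\in\mathbb R^{w_{\ell}\times w_{\ell+1}}$ ($0\le\ell<L$, $0\le k<K$), the manifold neural network (MNN) $\Phi_{\mathcal W}(\mathcal X,\mathcal L)$ has layers $\mathcal X_{\ell+1}=\rho\big(\sum_{k} (e^{-k\mathcal L}\mathcal X_\ell)W_{\ell k}\big)$, $\mathcal X_0=\mathcal X$, and the graph neural network (GNN)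 $\Phi_{\mathcal W}(X_n,L_n)$ has layers $X_{\ell+1}=\rho\big(\sum_k L_n^kX_\ell W_{\ell k}\big)$, $X_0=X_n$; the output is that of the last layer. The risk on $\mathcal M$ is $f(\mathcal W)=\int_{\mathcal M}\tilde l(\mathcal Y,\Phi_{\mathcal W}(\mathcal X,\mathcal L))\,d\mu$. On a graph whose $n$ nodes $u_1,\dots,u_n$ are sampled from $\mu$, put $x_i=\mathcal X(u_i)$, let $X_n$ have rows $x_i$, let $A_n$ have entries $e^{-\|x_i-x_j\|^2/(2\sigma^2)}$ for $i\ne j$ and $0$ for $i=j$, let $L_n=\mathrm{diag}(A_n\mathbf 1)-A_n$, and for a nonempty training set $\mathcal T$ of nodes let $l(Y_n,\Phi_{\mathcal W}(X_n,L_n))=\frac1{|\mathcal T|}\sum_{i\in\mathcal T}\tilde l(\mathcal Y(u_i),[\Phi_{\mathcal W}(X_n,L_n)]_i)$. **Learning.** Graphs $G_{n_0},G_{n_1},\dots$ are sampled independently, with independent nodes drawn from $\mu$ (any sizes $n_t\ge1$, in particular $n_t=n_0+t\,\Delta n$; any kernel widths $\sigma>0$). From a fixed $\mathcal W_0$, iterate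 $$\mathcal W_{k+1}=\mathcal W_k-\eta_k\nabla_{\mathcal W}\,l(Y_{n_t},\Phi_{\mathcal W_k}(X_{n_t},L_{n_t})),\qquad t=\lfloor k/\Delta t\rfloor .$$ **Assumptions.** On a convex set $S$ of weights that contains all iterates almost surely, the map $\mathcal W\mapsto\Phi_{\mathcal W}(\mathcal X,\mathcal L)\in L^2(\mathcal M;\mathbb R^{w_L})$ is differentiable and $\alpha$-Lipschitz, and its derivative is $\beta$-Lipschitz. The step sizes satisfy $0<\underline\eta\le\eta_k$ and $\eta_k(\alpha^2+\beta)<1$. For $\epsilon>0$, say that *the condition holds at step $k$* if, almost surely, $$\mathbb E\big[\|\nabla f(\mathcal W_k)-\nabla_{\mathcal W}\,l(Y_{n_t},\Phi_{\mathcal W_k}(X_{n_t},L_{n_t}))\|\;\big|\;\mathcal W_0,\dots,\mathcal W_k\big]<\|\nabla f(\mathcal W_k)\|-\epsilon ,$$ where the norm on the left is integrable. **Theorem.** There is a constant $C$ that depends on $\mathcal M$, $\mathcal X$, $\mathcal Y$, the architecture, $\tilde l$, $S$, $\alpha$, $\beta$, $\mathcal W_0$ and $\underline\eta$, but not on $\epsilon$,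 the graph sizes, the kernel widths, the training sets, $\Delta t$ or the step sizes, such that for every $\epsilon>0$: 1. if the condition holds at each step $k$ for which no iterate up to $\mathcal W_k$ is in the $\epsilon$-neighborhood $\{\mathbb E\|\nabla f\|\le\epsilon\}$ of first-order solutions of $\min f$, then there is $k^*\le C/\epsilon^2$ with $\mathbb E\|\nabla f(\mathcal W_{k^*})\|\le\epsilon$; 2. if the condition holds at each step $k$ for which no iterate up to $\mathcal W_k$ is in the $\epsilon$-neighborhood $\{\mathbb E f\le\inf f+\epsilon\}$ of the minimum risk, then there is $k^*\le C/\epsilon^2$ with $\mathbb E f(\mathcal W_{k^*})\le\inf_{\mathcal W} f(\mathcal W)+\epsilon$. -/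

import Mathlib

open MeasureTheory ProbabilityTheory
open scoped NNReal Gradient Matrix

noncomputable section

namespace MNN

/-! ### Embedded submanifolds and the Laplace-Beltrami operator -/

section Geometry

open scoped ContDiff

variable {F : ℕ}

/-- `M` is a smooth `d`-dimensional embedded submanifold (without boundary) of `ℝ^F`: around each of
its points a diffeomorphism of open sets flattens `M` onto a `d`-dimensional linear subspace. -/
def IsEmbeddedSubmanifold (d : ℕ) (M : Set (EuclideanSpace ℝ (Fin F))) : Prop :=
  ∀ p ∈ M, ∃ (φ : OpenPartialHomeomorph (EuclideanSpace ℝ (Fin F)) (EuclideanSpace ℝ (Fin F)))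
    (V : Submodule ℝ (EuclideanSpace ℝ (Fin F))),
    p ∈ φ.source ∧ Module.finrank ℝ V = d ∧
    ContDiffOn ℝ ∞ φ φ.source ∧ ContDiffOn ℝ ∞ φ.symm φ.target ∧
    φ '' (φ.source ∩ M) = φ.target ∩ (V : Set (EuclideanSpace ℝ (Fin F)))

/-- The tangent space of `M` at `p`: velocities of smooth curves in `M` through `p`. (For an embedded
submanifold these velocities already form a subspace.) -/
def tangentSpaceAt (M : Set (EuclideanSpace ℝ (Fin F))) (p : EuclideanSpace ℝ (Fin F)) :
    Submodule ℝ (EuclideanSpace ℝ (Fin F)) :=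
  Submodule.span ℝ {v | ∃ γ : ℝ → EuclideanSpace ℝ (Fin F),
    ContDiff ℝ ∞ γ ∧ (∀ t, γ t ∈ M) ∧ γ 0 = p ∧ deriv γ 0 = v}

/-- The gradient on `M` of (the restriction to `M` of) a smooth function `f` on the ambient space:
the tangential part of the ambient gradient. -/
def manifoldGradient (M : Set (EuclideanSpace ℝ (Fin F))) (f : EuclideanSpace ℝ (Fin F) → ℝ)
    (p : EuclideanSpace ℝ (Fin F)) : EuclideanSpace ℝ (Fin F) :=
  (tangentSpaceAt M p).starProjection (∇ f p)

/-- The divergence on `M` of a vector field `V` along `M`: `∑ i, ⟪∂_{e i} V, e i⟫` for an orthonormal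
basis `e` of the tangent space. Only the values of `V` on `M` matter, and `fderivWithin`
is uniquely determined on tangent vectors. -/
def manifoldDivergence (M : Set (EuclideanSpace ℝ (Fin F)))
    (V : EuclideanSpace ℝ (Fin F) → EuclideanSpace ℝ (Fin F)) (p : EuclideanSpace ℝ (Fin F)) : ℝ :=
  ∑ i, inner ℝ
    (fderivWithin ℝ V M p (stdOrthonormalBasis ℝ (tangentSpaceAt M p) i : EuclideanSpace ℝ (Fin F)))
    (stdOrthonormalBasis ℝ (tangentSpaceAt M p) i : EuclideanSpace ℝ (Fin F))

/-- The (nonnegative) Laplace-Beltrami operator of `M`. -/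
def laplaceBeltrami (M : Set (EuclideanSpace ℝ (Fin F))) (f : EuclideanSpace ℝ (Fin F) → ℝ)
    (p : EuclideanSpace ℝ (Fin F)) : ℝ :=
  -manifoldDivergence M (manifoldGradient M f) p

/-- The uniform probability measure on `M`: normalized `d`-dimensional volume. -/
def uniformMeasure (d : ℕ) (M : Set (EuclideanSpace ℝ (Fin F))) : Measure M :=
  (Measure.hausdorffMeasure (d : ℝ) (Set.univ : Set M))⁻¹ • Measure.hausdorffMeasure (d : ℝ)

/-- The space `L²(M)`. -/
abbrev L2 (d : ℕ) (M : Set (EuclideanSpace ℝ (Fin F))) : Type :=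
  Lp ℝ 2 (uniformMeasure d M)

open Classical in
/-- The class in `L²(M)` of a square integrable function on `M`. -/
def toL2 (d : ℕ) (M : Set (EuclideanSpace ℝ (Fin F))) (f : M → ℝ) : L2 d M :=
  if h : MemLp f 2 (uniformMeasure d M) then h.toLp f else 0

/-- A Hilbert basis of `L²(M)` consisting of smooth eigenfunctions of the Laplace-Beltrami operator,
with their eigenvalues. -/
structure LaplaceEigenbasis (d : ℕ) (M : Set (EuclideanSpace ℝ (Fin F))) where
  index : Type
  basis : HilbertBasis index ℝ (L2 d M)
  eigenvalue : index → ℝ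
  eigenfunction : index → EuclideanSpace ℝ (Fin F) → ℝ
  smooth : ∀ i, ContDiff ℝ ∞ (eigenfunction i)
  basis_ae_eq : ∀ i, (basis i : M → ℝ) =ᵐ[uniformMeasure d M] fun u : M => eigenfunction i u
  eigenvalue_nonneg : ∀ i, 0 ≤ eigenvalue i
  laplace_eq : ∀ i, ∀ u ∈ M,
    laplaceBeltrami M (eigenfunction i) u = eigenvalue i * eigenfunction i u

open Classical in
/-- The heat operator `e^{-tℒ}` on `L²(M)`: it multiplies the component along an eigenfunction with
eigenvalue `λ` by `e^{-tλ}`. It does not depend on the chosen eigenbasis, which exists for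
every compact embedded submanifold. -/
def heatOperator (d : ℕ) (M : Set (EuclideanSpace ℝ (Fin F))) (t : ℝ) (f : L2 d M) : L2 d M :=
  if h : Nonempty (LaplaceEigenbasis d M) then
    ∑' i : h.some.index,
      (Real.exp (-(t * h.some.eigenvalue i)) * h.some.basis.repr f i) • h.some.basis i
  else 0

end Geometry

/-! ### Architectures -/

/-- A nonlinearity: `ρ` and `ρ'` are 1-Lipschitz and `ρ 0 = 0`. -/
structure Nonlinearity where
  toFun : ℝ → ℝ
  differentiable : Differentiable ℝ toFun
  lipschitz : LipschitzWith 1 toFun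
  lipschitz_deriv : LipschitzWith 1 (deriv toFun)
  map_zero : toFun 0 = 0

/-- The parameters `𝒲 = {W_{ℓk}}`, `W_{ℓk} ∈ ℝ^{w ℓ × w (ℓ+1)}`, of a network with `L` layers,
`K` filter taps and widths `w 0, …, w L`, with the Euclidean norm of all the entries. -/
abbrev Weights (L K : ℕ) (w : ℕ → ℕ) : Type :=
  EuclideanSpace ℝ (Σ ℓ : Fin L, Fin K × Fin (w ℓ) × Fin (w (ℓ + 1)))

/-- The matrix of tap `k` of the layer from level `ℓ` to level `ℓ + 1` (for `ℓ < L`). -/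
def Weights.mat {L K : ℕ} {w : ℕ → ℕ} (W : Weights L K w) (ℓ : ℕ) (k : Fin K) :
    Matrix (Fin (w ℓ)) (Fin (w (ℓ + 1))) ℝ :=
  Matrix.of fun f g => if h : ℓ < L then W ⟨⟨ℓ, h⟩, k, f, g⟩ else 0

section Manifold

variable {F : ℕ} (d : ℕ) (M : Set (EuclideanSpace ℝ (Fin F))) {L K : ℕ} {w : ℕ → ℕ}
  (ρ : Nonlinearity) (X : M → EuclideanSpace ℝ (Fin (w 0)))

/-- The features of the manifold neural network at level `ℓ`. -/
def mnnLayer (W : Weights L K w) : (ℓ : ℕ) → Fin (w ℓ) → L2 d M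
  | 0 => fun f => toL2 d M fun u => X u f
  | ℓ + 1 => fun g => ρ.lipschitz.compLp ρ.map_zero
      (∑ k : Fin K, ∑ f : Fin (w ℓ),
        W.mat ℓ k f g • heatOperator d M ((k : ℕ) : ℝ) (mnnLayer W ℓ f))

/-- The output `Φ_W(𝒳, ℒ)` of the manifold neural network, in `L²(M; ℝ^{w L})`. -/
def mnn (W : Weights L K w) : PiLp 2 fun _ : Fin (w L) => L2 d M :=
  WithLp.toLp 2 (mnnLayer d M ρ X W L)

/-- The risk on the manifold: the mean over `M` of the loss between the labels and the output of the
manifold neural network. -/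
def manifoldRisk
    (loss : EuclideanSpace ℝ (Fin (w L)) → EuclideanSpace ℝ (Fin (w L)) → ℝ)
    (Y : M → EuclideanSpace ℝ (Fin (w L))) (W : Weights L K w) : ℝ :=
  ∫ u, loss (Y u) (WithLp.toLp 2 fun g => (mnn d M ρ X W g : M → ℝ) u) ∂(uniformMeasure d M)

end Manifold

section Graph

variable {n : ℕ}

/-- The weighted adjacency matrix of the geometric graph on `x 0, …, x (n-1)`. -/
def geometricAdjacency {m : ℕ} (σ : ℝ) (x : Fin n → EuclideanSpace ℝ (Fin m)) :
    Matrix (Fin n) (Fin n) ℝ :=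
  Matrix.of fun i j => if i = j then 0 else Real.exp (-(‖x i - x j‖ ^ 2 / (2 * σ ^ 2)))

/-- The Laplacian `diag (A 1) - A` of the geometric graph. -/
def geometricLaplacian {m : ℕ} (σ : ℝ) (x : Fin n → EuclideanSpace ℝ (Fin m)) :
    Matrix (Fin n) (Fin n) ℝ :=
  Matrix.diagonal (geometricAdjacency σ x *ᵥ 1) - geometricAdjacency σ x

variable {L K : ℕ} {w : ℕ → ℕ}

/-- The embeddings of the graph neural network with graph Laplacian `Λ` and node data `X₀`. -/
def gnnLayer (ρ : Nonlinearity) (Λ : Matrix (Fin n) (Fin n) ℝ)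
    (X₀ : Matrix (Fin n) (Fin (w 0)) ℝ) (W : Weights L K w) :
    (ℓ : ℕ) → Matrix (Fin n) (Fin (w ℓ)) ℝ
  | 0 => X₀
  | ℓ + 1 => (∑ k : Fin K, Λ ^ (k : ℕ) * gnnLayer ρ Λ X₀ W ℓ * W.mat ℓ k).map ρ.toFun

/-- The semi-supervised loss of the GNN on the geometric graph with nodes `u 0, …, u (n-1)` in `M`:
the mean of the loss over the training nodes `T`, the network seeing the data of all nodes. -/
def graphLoss {F : ℕ} {M : Set (EuclideanSpace ℝ (Fin F))}
    (ρ : Nonlinearity) (X : M → EuclideanSpace ℝ (Fin (w 0)))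
    (loss : EuclideanSpace ℝ (Fin (w L)) → EuclideanSpace ℝ (Fin (w L)) → ℝ)
    (Y : M → EuclideanSpace ℝ (Fin (w L))) (σ : ℝ) (u : Fin n → M) (T : Finset (Fin n))
    (W : Weights L K w) : ℝ :=
  (T.card : ℝ)⁻¹ * ∑ i ∈ T, loss (Y (u i))
    (WithLp.toLp 2 (gnnLayer ρ (geometricLaplacian σ fun j => X (u j))
      (Matrix.of fun j f => X (u j) f) W L i))

end Graph

/-- A standard loss function: nonnegative, and differentiable in the prediction, with Lipschitz
constant 1 for the loss and for its gradient. -/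
structure IsStandardLoss {c : ℕ}
    (loss : EuclideanSpace ℝ (Fin c) → EuclideanSpace ℝ (Fin c) → ℝ) : Prop where
  measurable : Measurable (Function.uncurry loss)
  nonneg : ∀ y z, 0 ≤ loss y z
  differentiable : ∀ y, Differentiable ℝ (loss y)
  lipschitz : ∀ y, LipschitzWith 1 (loss y)
  lipschitz_gradient : ∀ y, LipschitzWith 1 (∇ (loss y))

/-! ### Sampling and learning -/

section Learning

variable {Ω : Type*} [MeasurableSpace Ω]

/-- For every `t`, the `n t` nodes `u t 0, u t 1, …` of the `t`-th graph are drawn uniformly from `M`;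
all nodes of all graphs are independent. -/
structure IsUniformSampling {F : ℕ} (d : ℕ) (M : Set (EuclideanSpace ℝ (Fin F)))
    (P : Measure Ω) {n : ℕ → ℕ} (u : (t : ℕ) → Fin (n t) → Ω → M) : Prop where
  measurable : ∀ t i, Measurable (u t i)
  law : ∀ t i, P.map (u t i) = uniformMeasure d M
  indep : iIndepFun (fun q : Σ t, Fin (n t) => u q.1 q.2) P

variable {H : Type*} [NormedAddCommGroup H] [InnerProductSpace ℝ H] [CompleteSpace H]

/-- The iterates `W_{k+1} = W_k - η_k ∇ J_t(W_k)`, `t = ⌊k / Δt⌋`, where `J t` is the loss on the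
`t`-th graph. -/
def iterates (J : ℕ → H → ℝ) (η : ℕ → ℝ) (Δt : ℕ) (W₀ : H) : ℕ → H
  | 0 => W₀
  | k + 1 => iterates J η Δt W₀ k - η k • ∇ (J (k / Δt)) (iterates J η Δt W₀ k)

variable [MeasurableSpace H]

/-- The information in the iterates up to step `k`. -/
abbrev history (W : ℕ → Ω → H) (k : ℕ) : MeasurableSpace Ω :=
  ⨆ j : Fin (k + 1), MeasurableSpace.comap (W j) inferInstance

/-- The condition at step `k`: given the iterates so far, the expected distance between the gradients at
`W_k` of the risk `f` and of the current graph loss is less than `‖∇ f(W_k)‖ - ε`. -/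
def StepCondition (P : Measure Ω) (f : H → ℝ) (J : ℕ → Ω → H → ℝ) (Δt : ℕ) (ε : ℝ)
    (W : ℕ → Ω → H) (k : ℕ) : Prop :=
  Integrable (fun ω => ‖∇ f (W k ω) - ∇ (J (k / Δt) ω) (W k ω)‖) P ∧
  ∀ᵐ ω ∂P,
    (P[fun ω => ‖∇ f (W k ω) - ∇ (J (k / Δt) ω) (W k ω)‖ | history W k]) ω
      < ‖∇ f (W k ω)‖ - ε

/-- The random point `V` solves the minimization of `f` up to `ε` to first order: `𝔼 ‖∇ f(V)‖ ≤ ε`. -/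
def IsNearStationary (P : Measure Ω) (f : H → ℝ) (ε : ℝ) (V : Ω → H) : Prop :=
  Integrable (fun ω => ‖∇ f (V ω)‖) P ∧ ∫ ω, ‖∇ f (V ω)‖ ∂P ≤ ε

/-- The random point `V` minimizes `f` up to `ε` in value: `𝔼 f(V) ≤ inf f + ε`. -/
def IsNearMinimal (P : Measure Ω) (f : H → ℝ) (ε : ℝ) (V : Ω → H) : Prop :=
  Integrable (fun ω => f (V ω)) P ∧ ∫ ω, f (V ω) ∂P ≤ (⨅ W, f W) + ε

end Learning

end MNN

end

noncomputable section

/-! The argument is pathwise. The risk is `f = R ∘ Ψ`, where `Ψ` is the network as a map into `L²`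
and `R` is the mean loss, whose gradient is bounded by 1 and 1-Lipschitz. Hence the slope of `f`
along a segment in `S` grows at rate at most `α² + β` (`comp_le_add_fderiv_add_sq`), and a gradient
step with error below `‖∇f‖ - ε` lowers `f` by at least `η₀ε²/2` (`le_sub_of_inexact_gradient_step`,
`manifoldRisk_le_sub`).

A conditional mean error below the threshold does not make a step accurate almost surely, but it
does so with positive probability inside any event already known. Past accuracy is known from the
iterates, so by induction all of the first `N` steps are accurate together with positive probability
(`measure_forall_accurate_ne_zero`). On one such path `f` drops by `Nη₀ε²/2`; since `f ≥ 0`, the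
condition must fail at some step `k ≤ 2 f(W₀)/(η₀ε²)` (`exists_not_stepCondition`). By hypothesis it
can fail only if some iterate up to `k` is in the neighborhood. Nothing here depends on which
neighborhood is meant, so both claims follow at once. -/

/-! ### Measurability of gradients -/

theorem measurable_gradient {H : Type*} [NormedAddCommGroup H] [InnerProductSpace ℝ H]
    [CompleteSpace H] [MeasurableSpace H] [BorelSpace H] (f : H → ℝ) : Measurable (∇ f) :=
  (InnerProductSpace.toDual ℝ H).symm.continuous.measurable.comp (measurable_fderiv ℝ f)

/-- Each coordinate of the gradient is a pointwise limit of difference quotients, which are jointly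
measurable. It serves twice: with the label as parameter, and with the random outcome as parameter.
-/
theorem measurable_gradient_param {A ι : Type*} [MeasurableSpace A] [Fintype ι]
    {J : A → EuclideanSpace ℝ ι → ℝ} (hJ : Measurable (Function.uncurry J))
    (hd : ∀ a, Differentiable ℝ (J a)) :
    Measurable fun p : A × EuclideanSpace ℝ ι => ∇ (J p.1) p.2 := by
  classical
  suffices h : ∀ i, Measurable fun p : A × EuclideanSpace ℝ ι => ∇ (J p.1) p.2 i by
    have := (WithLp.measurable_toLp 2 (ι → ℝ)).comp (measurable_pi_lambda _ h)
    exact this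
  intro i
  have key : ∀ p : A × EuclideanSpace ℝ ι, Filter.Tendsto
      (fun m : ℕ => ((m : ℝ) + 1) *
        (J p.1 (p.2 + ((m : ℝ) + 1)⁻¹ • EuclideanSpace.single i 1) - J p.1 p.2))
      Filter.atTop (nhds (∇ (J p.1) p.2 i)) := by
    intro p
    have h1 := ((hd p.1) p.2).hasFDerivAt
    have hlim : Filter.Tendsto (fun m : ℕ => ‖(m : ℝ) + 1‖) Filter.atTop Filter.atTop :=
      Filter.tendsto_abs_atTop_atTop.comp
        (Filter.tendsto_atTop_add_const_right _ _ tendsto_natCast_atTop_atTop)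
    have h2 := h1.lim (EuclideanSpace.single i (1 : ℝ)) hlim
    rwa [← toDual_gradient, InnerProductSpace.toDual_apply_apply, real_inner_comm,
      EuclideanSpace.inner_single_left, map_one, one_mul] at h2
  refine measurable_of_tendsto_metrizable (fun m => ?_) (tendsto_pi_nhds.2 key)
  have h1 : Measurable fun p : A × EuclideanSpace ℝ ι =>
      J p.1 (p.2 + ((m : ℝ) + 1)⁻¹ • EuclideanSpace.single i 1) :=
    hJ.comp (measurable_fst.prodMk (measurable_snd.add_const _))
  exact (h1.sub hJ).const_mul _

/-! ### Regularity of the graph network and its loss -/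

theorem continuous_weights_mat {L K : ℕ} {w : ℕ → ℕ} (ℓ : ℕ) (k : Fin K) :
    Continuous fun W : MNN.Weights L K w => W.mat ℓ k := by
  refine continuous_matrix fun f g => ?_
  by_cases h : ℓ < L
  · simp only [MNN.Weights.mat, Matrix.of_apply, h, dite_true]; fun_prop
  · simp only [MNN.Weights.mat, Matrix.of_apply, h, dite_false]; fun_prop

theorem differentiable_weights_mat {L K : ℕ} {w : ℕ → ℕ} (ℓ : ℕ) (k : Fin K)
    (f : Fin (w ℓ)) (g : Fin (w (ℓ + 1))) :
    Differentiable ℝ fun W : MNN.Weights L K w => W.mat ℓ k f g := by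
  by_cases h : ℓ < L
  · simp only [MNN.Weights.mat, Matrix.of_apply, h, dite_true]; fun_prop
  · simp only [MNN.Weights.mat, Matrix.of_apply, h, dite_false]; fun_prop

theorem continuous_gnnLayer {A : Type*} [TopologicalSpace A] {n L K : ℕ} {w : ℕ → ℕ}
    (ρ : MNN.Nonlinearity) {Λ : A → Matrix (Fin n) (Fin n) ℝ}
    {X₀ : A → Matrix (Fin n) (Fin (w 0)) ℝ} (hΛ : Continuous Λ) (hX₀ : Continuous X₀) (ℓ : ℕ) :
    Continuous fun p : A × MNN.Weights L K w => MNN.gnnLayer ρ (Λ p.1) (X₀ p.1) p.2 ℓ := by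
  induction ℓ with
  | zero => exact hX₀.comp continuous_fst
  | succ ℓ ih =>
    refine Continuous.matrix_map (continuous_finsetSum _ fun k _ => ?_) ρ.lipschitz.continuous
    exact (((hΛ.comp continuous_fst).pow _).matrix_mul ih).matrix_mul
      ((continuous_weights_mat ℓ k).comp continuous_snd)

theorem differentiable_gnnLayer {n L K : ℕ} {w : ℕ → ℕ}
    (ρ : MNN.Nonlinearity) (Λ : Matrix (Fin n) (Fin n) ℝ)
    (X₀ : Matrix (Fin n) (Fin (w 0)) ℝ) (ℓ : ℕ) (i : Fin n) (g : Fin (w ℓ)) :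
    Differentiable ℝ fun W : MNN.Weights L K w => MNN.gnnLayer ρ Λ X₀ W ℓ i g := by
  induction ℓ generalizing i with
  | zero => exact differentiable_const _
  | succ ℓ ih =>
    simp only [MNN.gnnLayer, Matrix.map_apply, Matrix.sum_apply, Matrix.mul_apply]
    refine ρ.differentiable.comp (Differentiable.fun_sum fun k _ => Differentiable.fun_sum fun f _ =>
      Differentiable.mul (Differentiable.fun_sum fun j _ => ?_) (differentiable_weights_mat ℓ k f g))
    exact (ih j f).const_mul _

section GraphLoss

variable {F L K : ℕ} {w : ℕ → ℕ} {M : Set (EuclideanSpace ℝ (Fin F))} {n : ℕ}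

theorem continuous_geometricLaplacian {X : M → EuclideanSpace ℝ (Fin (w 0))} (hX : Continuous X)
    (σ : ℝ) : Continuous fun v : Fin n → M => MNN.geometricLaplacian σ fun j => X (v j) := by
  have hA : Continuous fun v : Fin n → M => MNN.geometricAdjacency σ fun j => X (v j) := by
    refine continuous_matrix fun i j => ?_
    by_cases h : i = j
    · simp only [MNN.geometricAdjacency, Matrix.of_apply, h, if_true]; fun_prop
    · simp only [MNN.geometricAdjacency, Matrix.of_apply, h, if_false, div_eq_mul_inv]
      fun_prop
  exact ((hA.matrix_mulVec continuous_const).matrix_diagonal).sub hA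

theorem differentiable_graphLoss {loss : EuclideanSpace ℝ (Fin (w L)) →
      EuclideanSpace ℝ (Fin (w L)) → ℝ} (hloss : ∀ y, Differentiable ℝ (loss y))
    (ρ : MNN.Nonlinearity) (X : M → EuclideanSpace ℝ (Fin (w 0)))
    (Y : M → EuclideanSpace ℝ (Fin (w L))) (σ : ℝ) (u : Fin n → M) (T : Finset (Fin n)) :
    Differentiable ℝ fun W : MNN.Weights L K w => MNN.graphLoss ρ X loss Y σ u T W := by
  unfold MNN.graphLoss
  refine (Differentiable.fun_sum fun i _ => (hloss _).comp ?_).const_mul _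
  rw [differentiable_euclidean]
  exact fun g => differentiable_gnnLayer ρ _ _ L i g

theorem measurable_graphLoss {Ω : Type*} [MeasurableSpace Ω]
    {loss : EuclideanSpace ℝ (Fin (w L)) → EuclideanSpace ℝ (Fin (w L)) → ℝ}
    (hloss : Measurable (Function.uncurry loss)) (ρ : MNN.Nonlinearity)
    {X : M → EuclideanSpace ℝ (Fin (w 0))} (hX : Continuous X)
    {Y : M → EuclideanSpace ℝ (Fin (w L))} (hY : Measurable Y) (σ : ℝ) {u : Fin n → Ω → M}
    (hu : ∀ i, Measurable (u i)) {T : Ω → Finset (Fin n)} (hT : ∀ s, MeasurableSet {ω | T ω = s}) :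
    Measurable (Function.uncurry fun (ω : Ω) (W : MNN.Weights L K w) =>
      MNN.graphLoss ρ X loss Y σ (fun i => u i ω) (T ω) W) := by
  classical
  have hterm : ∀ i : Fin n, Measurable fun p : Ω × MNN.Weights L K w => loss (Y (u i p.1))
      (WithLp.toLp 2 (MNN.gnnLayer ρ (MNN.geometricLaplacian σ fun j => X (u j p.1))
        (Matrix.of fun j f => X (u j p.1) f) p.2 L i)) := by
    intro i
    have hX₀ : Continuous fun v : Fin n → M =>
        (Matrix.of fun j f => X (v j) f : Matrix (Fin n) (Fin (w 0)) ℝ) :=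
      continuous_matrix fun j f => by simp only [Matrix.of_apply]; fun_prop
    have hc := continuous_gnnLayer (L := L) (K := K) ρ
      (continuous_geometricLaplacian (n := n) hX σ) hX₀ L
    have hrow : Continuous fun p : (Fin n → M) × MNN.Weights L K w =>
        (WithLp.toLp 2 (MNN.gnnLayer ρ (MNN.geometricLaplacian σ fun j => X (p.1 j))
          (Matrix.of fun j f => X (p.1 j) f) p.2 L i) : EuclideanSpace ℝ (Fin (w L))) :=
      (PiLp.continuous_toLp 2 _).comp ((continuous_apply i).comp hc)
    have hpt : Measurable fun p : Ω × MNN.Weights L K w => ((fun j => u j p.1, p.2) :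
        (Fin n → M) × MNN.Weights L K w) :=
      (measurable_pi_lambda _ fun j => (hu j).comp measurable_fst).prodMk measurable_snd
    exact hloss.comp ((hY.comp ((hu i).comp measurable_fst)).prodMk (hrow.measurable.comp hpt))
  -- The random training set takes finitely many values; splitting over them leaves a fixed set in
  -- each summand.
  have hsum : (Function.uncurry fun (ω : Ω) (W : MNN.Weights L K w) =>
      MNN.graphLoss ρ X loss Y σ (fun i => u i ω) (T ω) W) = fun p =>
      ∑ s : Finset (Fin n), {ω | T ω = s}.indicator 1 p.1 *
        MNN.graphLoss ρ X loss Y σ (fun i => u i p.1) s p.2 := by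
    ext p
    simp [Function.uncurry, Set.indicator_apply]
  rw [hsum]
  refine Finset.measurable_sum _ fun s _ =>
    ((measurable_one.indicator (hT s)).comp measurable_fst).mul ?_
  exact (Finset.measurable_sum _ fun i _ => hterm i).const_mul _

end GraphLoss

/-! ### The mean loss as a functional on `L²` -/

theorem Lp.norm_sq_eq_integral {A E : Type*} [MeasurableSpace A] {μ : Measure A}
    [NormedAddCommGroup E] [InnerProductSpace ℝ E] (f : Lp E 2 μ) :
    ‖f‖ ^ 2 = ∫ a, ‖f a‖ ^ 2 ∂μ := by
  rw [← real_inner_self_eq_norm_sq, L2.inner_def]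
  simp

section LossFunctional

variable {A ι : Type*} [MeasurableSpace A] {μ : Measure A} [Fintype ι]

/-- A tuple of square integrable functions, as a square integrable vector valued function. -/
def lpOfPiLp (μ : Measure A) (ι : Type*) [Fintype ι] :
    (PiLp 2 fun _ : ι => Lp ℝ 2 μ) →ₗᵢ[ℝ] Lp (EuclideanSpace ℝ ι) 2 μ where
  toFun h := MemLp.toLp (fun a => WithLp.toLp 2 fun i => (h i : A → ℝ) a)
    (memLp_piLp_iff.2 fun i => Lp.memLp (h i))
  map_add' h h' := by
    rw [← MemLp.toLp_add, MemLp.toLp_eq_toLp_iff]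
    filter_upwards [ae_all_iff.2 fun i => Lp.coeFn_add (h i) (h' i)] with a ha
    ext i
    simpa using ha i
  map_smul' c h := by
    rw [RingHom.id_apply, ← MemLp.toLp_const_smul, MemLp.toLp_eq_toLp_iff]
    filter_upwards [ae_all_iff.2 fun i => Lp.coeFn_smul c (h i)] with a ha
    ext i
    simpa using ha i
  norm_map' h := by
    refine (sq_eq_sq₀ (norm_nonneg _) (norm_nonneg _)).1 ?_
    have hi : ∀ i, Integrable (fun a => ‖(h i : A → ℝ) a‖ ^ 2) μ := fun i => by
      simpa [sq] using L2.integrable_inner (𝕜 := ℝ) (h i) (h i)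
    rw [Lp.norm_sq_eq_integral, PiLp.norm_sq_eq_of_L2]
    simp_rw [Lp.norm_sq_eq_integral]
    rw [← integral_finsetSum _ fun i _ => hi i]
    refine integral_congr_ae ?_
    have hm : MemLp (fun a => (WithLp.toLp 2 fun i => (h i : A → ℝ) a : EuclideanSpace ℝ ι)) 2 μ :=
      memLp_piLp_iff.2 fun i => Lp.memLp (h i)
    filter_upwards [hm.coeFn_toLp] with a ha
    rw [LinearMap.coe_mk, AddHom.coe_mk, ha, EuclideanSpace.norm_sq_eq]

theorem lpOfPiLp_coeFn (h : PiLp 2 fun _ : ι => Lp ℝ 2 μ) :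
    (lpOfPiLp μ ι h : A → EuclideanSpace ℝ ι) =ᵐ[μ] fun a => WithLp.toLp 2 fun i => (h i : A → ℝ) a :=
  MemLp.coeFn_toLp (memLp_piLp_iff.2 fun i => Lp.memLp (h i))

variable {c : ℕ} {loss : EuclideanSpace ℝ (Fin c) → EuclideanSpace ℝ (Fin c) → ℝ}
  {Y : A → EuclideanSpace ℝ (Fin c)}

theorem MNN.IsStandardLoss.norm_gradient_le (hl : MNN.IsStandardLoss loss)
    (y z : EuclideanSpace ℝ (Fin c)) : ‖∇ (loss y) z‖ ≤ 1 := by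
  have h := norm_fderiv_le_of_lipschitz ℝ (x₀ := z) (hl.lipschitz y)
  rwa [← toDual_gradient, LinearIsometryEquiv.norm_map, NNReal.coe_one] at h

/-- Mean value inequality for the loss minus its linear part, whose derivative on the segment is at
most `‖z' - z‖`. The factor 1/2 is given up: only a quadratic remainder is needed. -/
theorem MNN.IsStandardLoss.abs_sub_sub_inner_le (hl : MNN.IsStandardLoss loss)
    (y z z' : EuclideanSpace ℝ (Fin c)) :
    |loss y z' - loss y z - inner ℝ (∇ (loss y) z) (z' - z)| ≤ ‖z' - z‖ ^ 2 := by
  have hd : ∀ x ∈ segment ℝ z z', HasFDerivWithinAt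
      (fun x => loss y x - inner ℝ (∇ (loss y) z) x)
      (innerSL ℝ (∇ (loss y) x) - innerSL ℝ (∇ (loss y) z)) (segment ℝ z z') x := by
    intro x _
    have h1 : HasFDerivAt (loss y) (innerSL ℝ (∇ (loss y) x)) x :=
      ((hl.differentiable y) x).hasGradientAt.hasFDerivAt
    exact (h1.sub (innerSL ℝ (∇ (loss y) z)).hasFDerivAt).hasFDerivWithinAt
  have hb : ∀ x ∈ segment ℝ z z',
      ‖innerSL ℝ (∇ (loss y) x) - innerSL ℝ (∇ (loss y) z)‖ ≤ ‖z' - z‖ := by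
    intro x hx
    rw [← map_sub, innerSL_apply_norm]
    have h1 := (hl.lipschitz_gradient y).dist_le_mul x z
    rw [dist_eq_norm, dist_eq_norm, NNReal.coe_one, one_mul] at h1
    exact h1.trans (norm_sub_le_of_mem_segment hx)
  have h := (convex_segment z z').norm_image_sub_le_of_norm_hasFDerivWithin_le hd hb
    (left_mem_segment ℝ z z') (right_mem_segment ℝ z z')
  rw [Real.norm_eq_abs, ← sq] at h
  convert h using 2
  rw [inner_sub_right]; ring

variable [IsFiniteMeasure μ]

theorem MNN.IsStandardLoss.integrable_comp (hl : MNN.IsStandardLoss loss) (hY : Measurable Y)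
    (h0 : Integrable (fun a => loss (Y a) 0) μ) (z : Lp (EuclideanSpace ℝ (Fin c)) 2 μ) :
    Integrable (fun a => loss (Y a) (z a)) μ := by
  have hz : Integrable z μ := (Lp.memLp z).integrable one_le_two
  refine (h0.add hz.norm).mono' ?_ (Filter.Eventually.of_forall fun a => ?_)
  · exact (hl.measurable.comp_aemeasurable
      (hY.aemeasurable.prodMk (Lp.aestronglyMeasurable z).aemeasurable)).aestronglyMeasurable
  · have h1 := (hl.lipschitz (Y a)).dist_le_mul (z a) 0
    rw [Real.dist_eq, dist_zero_right, NNReal.coe_one, one_mul] at h1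
    rw [Real.norm_eq_abs, abs_of_nonneg (hl.nonneg _ _)]
    simp only [Pi.add_apply]
    linarith [le_abs_self (loss (Y a) (z a) - loss (Y a) 0)]

theorem MNN.IsStandardLoss.memLp_gradient (hl : MNN.IsStandardLoss loss) (hY : Measurable Y)
    (z : Lp (EuclideanSpace ℝ (Fin c)) 2 μ) : MemLp (fun a => ∇ (loss (Y a)) (z a)) 2 μ := by
  refine MemLp.of_bound ?_ 1 (Filter.Eventually.of_forall fun a => hl.norm_gradient_le _ _)
  exact ((measurable_gradient_param hl.measurable hl.differentiable).comp_aemeasurable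
    (hY.aemeasurable.prodMk (Lp.aestronglyMeasurable z).aemeasurable)).aestronglyMeasurable

/-- The gradient of the mean loss, as a functional of the prediction in `L²`. -/
def meanLossGradient (hl : MNN.IsStandardLoss loss) (hY : Measurable Y)
    (z : Lp (EuclideanSpace ℝ (Fin c)) 2 μ) : Lp (EuclideanSpace ℝ (Fin c)) 2 μ :=
  (hl.memLp_gradient hY z).toLp _

theorem norm_sub_meanLossGradient_le (hl : MNN.IsStandardLoss loss) (hY : Measurable Y)
    (z z' : Lp (EuclideanSpace ℝ (Fin c)) 2 μ) :
    ‖meanLossGradient hl hY z - meanLossGradient hl hY z'‖ ≤ ‖z - z'‖ := by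
  refine Lp.norm_le_norm_of_ae_le ?_
  filter_upwards [Lp.coeFn_sub z z', Lp.coeFn_sub (meanLossGradient hl hY z)
    (meanLossGradient hl hY z'), (hl.memLp_gradient hY z).coeFn_toLp,
    (hl.memLp_gradient hY z').coeFn_toLp] with a h1 h2 h3 h4
  rw [h1, h2, Pi.sub_apply, Pi.sub_apply, meanLossGradient, meanLossGradient, h3, h4]
  simpa [dist_eq_norm] using (hl.lipschitz_gradient (Y a)).dist_le_mul (z a) (z' a)

theorem norm_meanLossGradient_le {μ : Measure A} [IsProbabilityMeasure μ]
    (hl : MNN.IsStandardLoss loss) (hY : Measurable Y)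
    (z : Lp (EuclideanSpace ℝ (Fin c)) 2 μ) : ‖meanLossGradient hl hY z‖ ≤ 1 := by
  have h := Lp.norm_le_of_ae_bound (f := meanLossGradient hl hY z) zero_le_one (by
    filter_upwards [(hl.memLp_gradient hY z).coeFn_toLp] with a ha
    rw [meanLossGradient, ha]
    exact hl.norm_gradient_le _ _)
  simpa [measureUnivNNReal] using h

/-- The pointwise Taylor remainder is quadratic with a constant uniform in the label, so it
integrates to at most the squared `L²` distance. This gives Fréchet differentiability on `L²`. -/
theorem hasFDerivAt_integral_loss (hl : MNN.IsStandardLoss loss) (hY : Measurable Y)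
    (h0 : Integrable (fun a => loss (Y a) 0) μ) (z : Lp (EuclideanSpace ℝ (Fin c)) 2 μ) :
    HasFDerivAt (fun z : Lp (EuclideanSpace ℝ (Fin c)) 2 μ => ∫ a, loss (Y a) (z a) ∂μ)
      (innerSL ℝ (meanLossGradient hl hY z)) z := by
  have key : ∀ z' : Lp (EuclideanSpace ℝ (Fin c)) 2 μ,
      ‖(∫ a, loss (Y a) (z' a) ∂μ) - (∫ a, loss (Y a) (z a) ∂μ)
        - innerSL ℝ (meanLossGradient hl hY z) (z' - z)‖ ≤ ‖z' - z‖ ^ 2 := by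
    intro z'
    have hi' := hl.integrable_comp hY h0 z'
    have hi := hl.integrable_comp hY h0 z
    have hin := L2.integrable_inner (𝕜 := ℝ) (meanLossGradient hl hY z) (z' - z)
    rw [innerSL_apply_apply, L2.inner_def, ← integral_sub hi' hi,
      ← integral_sub (by exact hi'.sub hi) hin, Lp.norm_sq_eq_integral]
    refine norm_integral_le_of_norm_le ?_ ?_
    · have := L2.integrable_inner (𝕜 := ℝ) (z' - z) (z' - z)
      simpa using this
    · filter_upwards [Lp.coeFn_sub z' z, (hl.memLp_gradient hY z).coeFn_toLp] with a h1 h2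
      rw [meanLossGradient, h1, h2, Real.norm_eq_abs]
      exact hl.abs_sub_sub_inner_le _ _ _
  rw [hasFDerivAt_iff_isLittleO]
  have h1 : (fun z' : Lp (EuclideanSpace ℝ (Fin c)) 2 μ => ‖z' - z‖ ^ 2)
      =o[nhds z] fun z' => z' - z := by
    refine Asymptotics.IsLittleO.of_norm_right ?_
    have h2 : Filter.Tendsto (fun z' => ‖z' - z‖) (nhds z) (nhds 0) := by
      have : Continuous fun z' => ‖z' - z‖ := by fun_prop
      simpa using this.tendsto z
    exact (Asymptotics.isLittleO_pow_id one_lt_two).comp_tendsto h2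
  refine (Asymptotics.IsBigO.of_bound 1 (Filter.Eventually.of_forall fun z' => ?_)).trans_isLittleO h1
  rw [one_mul]
  exact (key z').trans (le_abs_self _)

end LossFunctional
end

/-! ### Descent for inexact gradient steps -/

/-- The descent inequality for `R ∘ Ψ` along a segment in a convex set on which `Ψ` and its derivative
are Lipschitz; the set may have empty interior. -/
theorem comp_le_add_fderiv_add_sq {H E : Type*} [NormedAddCommGroup H] [NormedSpace ℝ H]
    [NormedAddCommGroup E] [NormedSpace ℝ E] {R : E → ℝ} {D : E → E →L[ℝ] ℝ}
    (hR : ∀ z, HasFDerivAt R (D z) z) (hD : ∀ z, ‖D z‖ ≤ 1)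
    (hDlip : ∀ z z', ‖D z - D z'‖ ≤ ‖z - z'‖) {Ψ : H → E} {S : Set H} (hS : Convex ℝ S) {α β : ℝ≥0}
    (hdiff : ∀ x ∈ S, DifferentiableAt ℝ Ψ x) (hα : LipschitzOnWith α Ψ S)
    (hβ : LipschitzOnWith β (fderiv ℝ Ψ) S) {x y : H} (hx : x ∈ S) (hy : y ∈ S) :
    R (Ψ y) ≤ R (Ψ x) + D (Ψ x) (fderiv ℝ Ψ x (y - x)) + ((α : ℝ) ^ 2 + β) / 2 * ‖y - x‖ ^ 2 := by
  set v := y - x with hv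
  set p : ℝ → H := fun s => x + s • v with hp
  have hpS : ∀ s ∈ Set.Icc (0 : ℝ) 1, p s ∈ S := fun s hs => by
    have h : p s = (1 - s) • x + s • y := by simp only [hp, hv]; module
    rw [h]
    exact hS hx hy (by linarith [hs.2]) hs.1 (by ring)
  have hpd : ∀ s, HasDerivAt p v s := fun s => by
    have h := ((hasDerivAt_id s).smul_const v).const_add x
    rwa [one_smul] at h
  have hpn : ∀ s t, ‖p s - p t‖ = |s - t| * ‖v‖ := fun s t => by
    rw [← Real.norm_eq_abs, ← norm_smul]; congr 1; simp only [hp]; module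
  have hΨd : ∀ s ∈ Set.Icc (0 : ℝ) 1, HasDerivAt (Ψ ∘ p) (fderiv ℝ Ψ (p s) v) s := fun s hs =>
    (hdiff _ (hpS s hs)).hasFDerivAt.comp_hasDerivAt s (hpd s)
  have hφd : ∀ s ∈ Set.Icc (0 : ℝ) 1,
      HasDerivAt (R ∘ (Ψ ∘ p)) (D (Ψ (p s)) (fderiv ℝ Ψ (p s) v)) s := fun s hs =>
    (hR _).comp_hasDerivAt s (hΨd s hs)
  -- Since `S` may have empty interior, its Lipschitz constant does not bound the full derivative of
  -- `Ψ`. Along the segment it does bound the derivative in direction `v`, at interior parameters.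
  have hdir : ∀ s ∈ Set.Ioo (0 : ℝ) 1, ‖fderiv ℝ Ψ (p s) v‖ ≤ α * ‖v‖ := by
    intro s hs
    have hlip : LipschitzOnWith (α * ‖v‖₊) (Ψ ∘ p) (Set.Icc 0 1) := by
      refine LipschitzOnWith.of_dist_le_mul fun a ha b hb => ?_
      refine (hα.dist_le_mul _ (hpS a ha) _ (hpS b hb)).trans (le_of_eq ?_)
      rw [dist_eq_norm, hpn, Real.dist_eq]
      push_cast
      ring
    simpa using (hΨd s (Set.Ioo_subset_Icc_self hs)).le_of_lipschitzOn
      (Icc_mem_nhds hs.1 hs.2) hlip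
  have h0 : p 0 = x := by simp [hp]
  have h1 : p 1 = y := by simp [hp, hv]
  set c : ℝ := (α : ℝ) ^ 2 + β with hc
  -- Changing the base point of `D` costs `α²` (once from `Ψ`, once from its directional
  -- derivative); changing that of `fderiv ℝ Ψ` costs `β`.
  have hslope : ∀ s ∈ Set.Ioo (0 : ℝ) 1, D (Ψ (p s)) (fderiv ℝ Ψ (p s) v) ≤
      D (Ψ x) (fderiv ℝ Ψ x v) + c * ‖v‖ ^ 2 * s := by
    intro s hs
    have hs' := Set.Ioo_subset_Icc_self hs
    have hpx : ‖p s - x‖ = s * ‖v‖ := by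
      rw [← h0, hpn, sub_zero, abs_of_pos hs.1]
    have e1 : D (Ψ (p s)) (fderiv ℝ Ψ (p s) v) - D (Ψ x) (fderiv ℝ Ψ (p s) v)
        ≤ (α * (s * ‖v‖)) * (α * ‖v‖) := by
      rw [← _root_.sub_apply]
      refine (le_abs_self _).trans (((D (Ψ (p s)) - D (Ψ x)).le_opNorm _).trans ?_)
      refine mul_le_mul ((hDlip _ _).trans ?_) (hdir s hs) (norm_nonneg _)
        (mul_nonneg α.2 (mul_nonneg hs.1.le (norm_nonneg _)))
      rw [← hpx, ← dist_eq_norm, ← dist_eq_norm]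
      exact hα.dist_le_mul _ (hpS s hs') _ hx
    have e2 : D (Ψ x) (fderiv ℝ Ψ (p s) v) - D (Ψ x) (fderiv ℝ Ψ x v)
        ≤ (β * (s * ‖v‖)) * ‖v‖ := by
      rw [← map_sub, ← _root_.sub_apply]
      refine (le_abs_self _).trans (((D (Ψ x)).le_opNorm _).trans ?_)
      refine (mul_le_of_le_one_left (norm_nonneg _) (hD _)).trans
        ((ContinuousLinearMap.le_opNorm _ _).trans ?_)
      refine mul_le_mul_of_nonneg_right ?_ (norm_nonneg _)
      rw [← hpx, ← dist_eq_norm, ← dist_eq_norm]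
      exact hβ.dist_le_mul _ (hpS s hs') _ hx
    rw [hc]
    linarith
  have hq : ∀ s : ℝ, HasDerivAt
      (fun s : ℝ => D (Ψ x) (fderiv ℝ Ψ x v) * s + c * ‖v‖ ^ 2 / 2 * s ^ 2)
      (D (Ψ x) (fderiv ℝ Ψ x v) + c * ‖v‖ ^ 2 * s) s := fun s => by
    have h := ((hasDerivAt_id s).const_mul (D (Ψ x) (fderiv ℝ Ψ x v))).add
      ((hasDerivAt_pow 2 s).const_mul (c * ‖v‖ ^ 2 / 2))
    refine h.congr_deriv ?_
    push_cast
    ring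
  -- The quadratic with the dominating slope, minus `R ∘ Ψ ∘ p`, is nondecreasing; comparing its
  -- ends gives the claim.
  have hmono : MonotoneOn (fun s : ℝ => D (Ψ x) (fderiv ℝ Ψ x v) * s + c * ‖v‖ ^ 2 / 2 * s ^ 2
      - (R ∘ (Ψ ∘ p)) s) (Set.Icc 0 1) := by
    refine monotoneOn_of_deriv_nonneg (convex_Icc 0 1)
      (fun s hs => ((hq s).sub (hφd s hs)).continuousAt.continuousWithinAt) ?_ ?_
    · intro s hs
      exact ((hq s).sub (hφd s (interior_subset hs))).differentiableAt.differentiableWithinAt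
    · intro s hs
      rw [interior_Icc] at hs
      have h := ((hq s).sub (hφd s (Set.Ioo_subset_Icc_self hs))).deriv
      have h' := hslope s hs
      simp only [Pi.sub_def] at h
      rw [h]
      linarith
  have := hmono (Set.left_mem_Icc.2 zero_le_one) (Set.right_mem_Icc.2 zero_le_one) zero_le_one
  simp only [Function.comp_apply, h0, h1] at this
  linarith

/-- An inexact gradient step decreases the function, if the error is smaller than the gradient. -/
theorem le_sub_of_inexact_gradient_step {H : Type*} [NormedAddCommGroup H] [InnerProductSpace ℝ H]
    {f₀ f₁ c η η₀ ε : ℝ} {a g : H} (hdesc : f₁ ≤ f₀ + inner ℝ a (-(η • g)) + c / 2 * ‖-(η • g)‖ ^ 2)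
    (hη₀ : 0 < η₀) (hη : η₀ ≤ η) (hc : η * c < 1) (hε : 0 < ε) (he : ‖a - g‖ < ‖a‖ - ε) :
    f₁ ≤ f₀ - η₀ * ε ^ 2 / 2 := by
  have hη' : 0 < η := hη₀.trans_le hη
  have h1 : ‖a - g‖ ^ 2 = ‖a‖ ^ 2 - 2 * inner ℝ a g + ‖g‖ ^ 2 := norm_sub_sq_real a g
  rw [inner_neg_right, inner_smul_right, norm_neg, norm_smul, Real.norm_eq_abs, abs_of_pos hη'] at hdesc
  -- Because `η * c < 1`, the second-order term is absorbed, and what remains is `-(η/2)(‖a‖² - ‖a -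
  -- g‖²)`.
  have h2 : c / 2 * (η * ‖g‖) ^ 2 ≤ η / 2 * ‖g‖ ^ 2 := by
    have := mul_le_mul_of_nonneg_right hc.le (mul_nonneg (half_pos hη').le (sq_nonneg ‖g‖))
    linarith
  have h3 : ε ^ 2 ≤ ‖a‖ ^ 2 - ‖a - g‖ ^ 2 := by nlinarith [norm_nonneg (a - g)]
  have h4 : η₀ * ε ^ 2 ≤ η * (‖a‖ ^ 2 - ‖a - g‖ ^ 2) := by gcongr
  rw [h1] at h4
  linarith

/-! ### Accurate steps with positive probability -/

section PositiveProbability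

variable {Ω : Type*} {m₀ : MeasurableSpace Ω} {P : Measure Ω} [IsProbabilityMeasure P]

/-- If the conditional expectation of `e` is less than `a` almost surely, then `e < a` with positive
probability within every event of positive probability that is known to the conditioning. -/
theorem measure_inter_lt_ne_zero_of_condExp_lt {m : MeasurableSpace Ω} (hm : m ≤ m₀) {E : Set Ω}
    (hE : MeasurableSet[m] E) (hPE : P E ≠ 0) {e a : Ω → ℝ} (he : Integrable e P)
    (hlt : ∀ᵐ ω ∂P, (P[e | m]) ω < a ω) : P (E ∩ {ω | e ω < a ω}) ≠ 0 := by
  intro h0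
  -- If the claim failed, `e ≥ a` almost everywhere on `E`, so `e` would strictly exceed its
  -- conditional expectation there, although both have the same integral over `E`.
  have hle : ∀ᵐ ω ∂P.restrict E, (P[e | m]) ω < e ω := by
    rw [ae_restrict_iff' (hm _ hE)]
    have h0' : ∀ᵐ ω ∂P, ω ∉ E ∩ {ω | e ω < a ω} := measure_eq_zero_iff_ae_notMem.1 h0
    filter_upwards [hlt, h0'] with ω h1 h2 hωE
    exact h1.trans_le (not_lt.1 fun h => h2 ⟨hωE, h⟩)
  have hint : ∫ ω in E, (e ω - (P[e | m]) ω) ∂P = 0 := by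
    rw [integral_sub he.integrableOn integrable_condExp.integrableOn, setIntegral_condExp hm he hE,
      sub_self]
  have hz := (integral_eq_zero_iff_of_nonneg_ae (hle.mono fun ω h => (sub_pos.2 h).le)
    (he.sub integrable_condExp).integrableOn).1 hint
  have hF : ∀ᵐ ω ∂P.restrict E, False := by
    filter_upwards [hle, hz] with ω h1 h2
    exact (sub_pos.2 h1).ne' h2
  exact hPE (Measure.restrict_eq_zero.1 (ae_eq_bot.1 (Filter.eventually_false_iff_eq_bot.1 hF)))

variable {H : Type*} [NormedAddCommGroup H] [InnerProductSpace ℝ H] [CompleteSpace H]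
  [MeasurableSpace H] [BorelSpace H] [SecondCountableTopology H]

/-- For use with consecutive iterates `V`, `V'` and `c` the inverse step size: then `c • (V - V')`
is the gradient used in the step. -/
theorem measurableSet_norm_gradient_sub_lt {m : MeasurableSpace Ω} (f : H → ℝ) (ε c : ℝ)
    {V V' : Ω → H} (hV : Measurable V) (hV' : Measurable V') :
    MeasurableSet {ω | ‖∇ f (V ω) - c • (V ω - V' ω)‖ < ‖∇ f (V ω)‖ - ε} := by
  have h := (measurable_gradient f).comp hV
  exact measurableSet_lt (h.sub ((hV.sub hV').const_smul c)).norm (h.norm.sub_const ε)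

/-- Under the step conditions, all steps up to a given one are accurate with positive probability. -/
theorem measure_forall_accurate_ne_zero {f : H → ℝ} {J : ℕ → Ω → H → ℝ} {Δt : ℕ} {ε : ℝ}
    {η : ℕ → ℝ} (hη : ∀ k, 0 < η k) {W : ℕ → Ω → H} (hWm : ∀ k, Measurable (W k))
    (hW : ∀ k ω, W (k + 1) ω = W k ω - η k • ∇ (J (k / Δt) ω) (W k ω)) {N : ℕ}
    (hcond : ∀ k < N, MNN.StepCondition P f J Δt ε W k) :
    ∀ k ≤ N, P {ω | ∀ j < k, ‖∇ f (W j ω) - ∇ (J (j / Δt) ω) (W j ω)‖ < ‖∇ f (W j ω)‖ - ε} ≠ 0 := by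
  intro k
  induction k with
  | zero => intro _; simp
  | succ k ih =>
    intro hk
    obtain ⟨hint, hlt⟩ := hcond k hk
    have hWh : ∀ j ≤ k, Measurable[MNN.history W k] (W j) := fun j hj =>
      measurable_iff_comap_le.2 (le_iSup (fun i : Fin (k + 1) =>
        MeasurableSpace.comap (W i) inferInstance) ⟨j, Nat.lt_succ_of_le hj⟩)
    have hm : MNN.history W k ≤ m₀ := iSup_le fun j => (hWm j).comap_le
    -- The sampled gradient can be read off from two consecutive iterates, so no knowledge of the
    -- graph is required.
    have hstep : ∀ j ω, ∇ (J (j / Δt) ω) (W j ω) = (η j)⁻¹ • (W j ω - W (j + 1) ω) := fun j ω => by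
      rw [hW, sub_sub_cancel, smul_smul, inv_mul_cancel₀ (hη j).ne', one_smul]
    -- Accuracy of step `j` involves `W (j + 1)`; for `j < k` this is still in the history at `k`.
    have hE : MeasurableSet[MNN.history W k] {ω | ∀ j < k,
        ‖∇ f (W j ω) - ∇ (J (j / Δt) ω) (W j ω)‖ < ‖∇ f (W j ω)‖ - ε} := by
      simp only [hstep, Set.ofPred_forall]
      refine MeasurableSet.iInter fun j => MeasurableSet.iInter fun hj => ?_
      exact measurableSet_norm_gradient_sub_lt f ε (η j)⁻¹ (hWh j hj.le) (hWh (j + 1) hj)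
    have h := measure_inter_lt_ne_zero_of_condExp_lt hm hE (ih (Nat.le_of_succ_le hk)) hint hlt
    convert h using 3
    ext ω
    simp only [Set.mem_ofPred_eq, Set.mem_inter_iff, Nat.lt_succ_iff_lt_or_eq, or_imp, forall_and,
      forall_eq]

/-- If accurate steps decrease a nonnegative function by at least `δ`, then the step conditions hold
at fewer than `f W₀ / δ` consecutive steps. -/
theorem exists_not_stepCondition {f : H → ℝ} (hf : ∀ x, 0 ≤ f x) {J : ℕ → Ω → H → ℝ} {Δt : ℕ}
    {ε δ : ℝ} {η : ℕ → ℝ} (hη : ∀ k, 0 < η k) {W₀ : H} {W : ℕ → Ω → H}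
    (hWm : ∀ k, Measurable (W k)) (hW0 : ∀ ω, W 0 ω = W₀)
    (hW : ∀ k ω, W (k + 1) ω = W k ω - η k • ∇ (J (k / Δt) ω) (W k ω))
    (hdec : ∀ᵐ ω ∂P, ∀ k, ‖∇ f (W k ω) - ∇ (J (k / Δt) ω) (W k ω)‖ < ‖∇ f (W k ω)‖ - ε →
      f (W (k + 1) ω) ≤ f (W k ω) - δ) {N : ℕ} (hN : f W₀ < N * δ) :
    ∃ k < N, ¬ MNN.StepCondition P f J Δt ε W k := by
  by_contra! hcond
  have hpos := measure_forall_accurate_ne_zero hη hWm hW hcond N le_rfl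
  -- An event of positive probability meets the almost sure event on which accurate steps decrease
  -- `f`.
  obtain ⟨ω, hω, hω'⟩ : ∃ ω, (∀ j < N,
      ‖∇ f (W j ω) - ∇ (J (j / Δt) ω) (W j ω)‖ < ‖∇ f (W j ω)‖ - ε) ∧
      ∀ k, ‖∇ f (W k ω) - ∇ (J (k / Δt) ω) (W k ω)‖ < ‖∇ f (W k ω)‖ - ε →
        f (W (k + 1) ω) ≤ f (W k ω) - δ := by
    by_contra! hno
    refine hpos (measure_eq_zero_iff_ae_notMem.2 ?_)
    filter_upwards [hdec] with ω h1 h2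
    obtain ⟨k, hk, hk'⟩ := hno ω h2
    exact hk'.not_ge (h1 k hk)
  have hdesc : ∀ k ≤ N, f (W k ω) ≤ f W₀ - k * δ := by
    intro k
    induction k with
    | zero => intro _; simp [hW0]
    | succ k ih =>
      intro hk
      have h1 := ih (Nat.le_of_succ_le hk)
      have h2 := hω' k (hω k hk)
      push_cast
      linarith
  linarith [hdesc N le_rfl, hf (W N ω)]

end PositiveProbability

/-! ### Application to the learning iterates -/

theorem measurable_iterates {Ω ι : Type*} [MeasurableSpace Ω] [Fintype ι]
    {J : ℕ → Ω → EuclideanSpace ℝ ι → ℝ} (hJ : ∀ t, Measurable (Function.uncurry (J t)))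
    (hd : ∀ t ω, Differentiable ℝ (J t ω)) (η : ℕ → ℝ) (Δt : ℕ) (W₀ : EuclideanSpace ℝ ι) (k : ℕ) :
    Measurable fun ω => MNN.iterates (fun t => J t ω) η Δt W₀ k := by
  induction k with
  | zero => exact measurable_const
  | succ k ih =>
    exact ih.sub (((measurable_gradient_param (hJ _) (hd _)).comp
      (measurable_id.prodMk ih)).const_smul (η k))

/-- An inexact gradient step on the risk of the manifold neural network decreases the risk. -/
theorem manifoldRisk_le_sub {F d L K : ℕ} {w : ℕ → ℕ} {M : Set (EuclideanSpace ℝ (Fin F))}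
    [IsProbabilityMeasure (MNN.uniformMeasure d M)] (X : M → EuclideanSpace ℝ (Fin (w 0)))
    {Y : M → EuclideanSpace ℝ (Fin (w L))} (hY : Measurable Y) (ρ : MNN.Nonlinearity)
    {loss : EuclideanSpace ℝ (Fin (w L)) → EuclideanSpace ℝ (Fin (w L)) → ℝ}
    (hloss : MNN.IsStandardLoss loss)
    (hrisk : Integrable (fun u => loss (Y u) 0) (MNN.uniformMeasure d M))
    {S : Set (MNN.Weights L K w)} (hS : Convex ℝ S) {α β : ℝ≥0}
    (hdiff : ∀ W ∈ S, DifferentiableAt ℝ (fun W : MNN.Weights L K w => MNN.mnn d M ρ X W) W)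
    (hα : LipschitzOnWith α (fun W : MNN.Weights L K w => MNN.mnn d M ρ X W) S)
    (hβ : LipschitzOnWith β (fderiv ℝ fun W : MNN.Weights L K w => MNN.mnn d M ρ X W) S)
    {η₀ η ε : ℝ} (hη₀ : 0 < η₀) (hη : η₀ ≤ η) (hc : η * ((α : ℝ) ^ 2 + β) < 1) (hε : 0 < ε)
    {V g : MNN.Weights L K w} (hV : V ∈ S) (hV' : V - η • g ∈ S)
    (he : ‖∇ (MNN.manifoldRisk d M ρ X loss Y) V - g‖
      < ‖∇ (MNN.manifoldRisk d M ρ X loss Y) V‖ - ε) :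
    MNN.manifoldRisk d M ρ X loss Y (V - η • g) ≤
      MNN.manifoldRisk d M ρ X loss Y V - η₀ * ε ^ 2 / 2 := by
  set μ := MNN.uniformMeasure d M
  set Ψ := fun W : MNN.Weights L K w => MNN.mnn d M ρ X W with hΨ
  set ι := lpOfPiLp μ (Fin (w L)) with hι
  set R : (PiLp 2 fun _ : Fin (w L) => MNN.L2 d M) → ℝ :=
    fun z => ∫ a, loss (Y a) (ι z a) ∂μ with hR
  set D : (PiLp 2 fun _ : Fin (w L) => MNN.L2 d M) → _ →L[ℝ] ℝ := fun z =>
    (innerSL ℝ (meanLossGradient hloss hY (ι z))).comp ι.toContinuousLinearMap with hD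
  have hfR : MNN.manifoldRisk d M ρ X loss Y = R ∘ Ψ := by
    ext W
    refine integral_congr_ae ?_
    filter_upwards [lpOfPiLp_coeFn (MNN.mnn d M ρ X W)] with a ha
    rw [hι, hΨ, ha]
  have hRD : ∀ z, HasFDerivAt R (D z) z := fun z =>
    (hasFDerivAt_integral_loss hloss hY hrisk (ι z)).comp z ι.toContinuousLinearMap.hasFDerivAt
  have hcomp : ∀ v : Lp (EuclideanSpace ℝ (Fin (w L))) 2 μ,
      ‖(innerSL ℝ v).comp ι.toContinuousLinearMap‖ ≤ ‖v‖ := fun v =>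
    ContinuousLinearMap.opNorm_le_bound _ (norm_nonneg _) fun z => by
      simpa using norm_inner_le_norm (𝕜 := ℝ) v (ι z)
  have hD1 : ∀ z, ‖D z‖ ≤ 1 := fun z => (hcomp _).trans (norm_meanLossGradient_le hloss hY _)
  have hDlip : ∀ z z', ‖D z - D z'‖ ≤ ‖z - z'‖ := fun z z' => by
    rw [hD, ← ContinuousLinearMap.sub_comp, ← map_sub]
    refine (hcomp _).trans ((norm_sub_meanLossGradient_le hloss hY _ _).trans ?_)
    rw [← map_sub, LinearIsometry.norm_map]
  -- Both ends of the step lie in `S`, so by convexity the whole segment does.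
  have hdesc := comp_le_add_fderiv_add_sq hRD hD1 hDlip hS hdiff hα hβ hV hV'
  have hgrad : D (Ψ V) (fderiv ℝ Ψ V (V - η • g - V)) =
      inner ℝ (∇ (MNN.manifoldRisk d M ρ X loss Y) V) (V - η • g - V) := by
    rw [← InnerProductSpace.toDual_apply_apply, toDual_gradient, hfR,
      ((hRD _).comp V (hdiff V hV).hasFDerivAt).fderiv]
    rfl
  rw [hgrad, sub_sub_cancel_left] at hdesc
  exact le_sub_of_inexact_gradient_step (by rw [hfR] at hdesc ⊢; exact hdesc) hη₀ hη hc hε he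

theorem theorem3 {F d L K : ℕ} (w : ℕ → ℕ)
    (M : Set (EuclideanSpace ℝ (Fin F))) (hM : IsCompact M) (hMd : MNN.IsEmbeddedSubmanifold d M)
    (X : M → EuclideanSpace ℝ (Fin (w 0))) (hX : Continuous X)
    (Y : M → EuclideanSpace ℝ (Fin (w L))) (hY : Measurable Y)
    (ρ : MNN.Nonlinearity)
    (loss : EuclideanSpace ℝ (Fin (w L)) → EuclideanSpace ℝ (Fin (w L)) → ℝ)
    (hloss : MNN.IsStandardLoss loss)
    (hrisk : Integrable (fun u => loss (Y u) 0) (MNN.uniformMeasure d M))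
    -- the manifold neural network and its gradient are Lipschitz in the parameters, on `S`
    (S : Set (MNN.Weights L K w)) (hS : Convex ℝ S) (α β : ℝ≥0)
    (hdiff : ∀ W ∈ S, DifferentiableAt ℝ (fun W : MNN.Weights L K w => MNN.mnn d M ρ X W) W)
    (hα : LipschitzOnWith α (fun W : MNN.Weights L K w => MNN.mnn d M ρ X W) S)
    (hβ : LipschitzOnWith β (fderiv ℝ fun W : MNN.Weights L K w => MNN.mnn d M ρ X W) S)
    (W₀ : MNN.Weights L K w) (η₀ : ℝ) (hη₀ : 0 < η₀) :
    ∃ C : ℝ, ∀ ε : ℝ, 0 < ε →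
      ∀ (Ω : Type*) [MeasurableSpace Ω] (P : Measure Ω) [IsProbabilityMeasure P]
        -- graph sizes, kernel widths, nodes, training nodes
        (n : ℕ → ℕ) (_ : ∀ t, 1 ≤ n t) (σ : ℕ → ℝ) (_ : ∀ t, 0 < σ t)
        (u : (t : ℕ) → Fin (n t) → Ω → M) (_ : MNN.IsUniformSampling d M P u)
        (T : (t : ℕ) → Ω → Finset (Fin (n t))) (_ : ∀ t ω, (T t ω).Nonempty)
        (_ : ∀ t s, MeasurableSet {ω | T t ω = s})
        -- resampling period and step sizes
        (Δt : ℕ) (_ : 1 ≤ Δt)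
        (η : ℕ → ℝ) (_ : ∀ k, η₀ ≤ η k) (_ : ∀ k, η k * ((α : ℝ) ^ 2 + β) < 1)
        (J : ℕ → Ω → MNN.Weights L K w → ℝ)
        (_ : J = fun t ω => MNN.graphLoss ρ X loss Y (σ t) (fun i => u t i ω) (T t ω))
        (W : ℕ → Ω → MNN.Weights L K w)
        (_ : W = fun k ω => MNN.iterates (fun t => J t ω) η Δt W₀ k)
        (_ : ∀ k, ∀ᵐ ω ∂P, W k ω ∈ S),
        ((∀ k, (∀ j ≤ k, ¬ MNN.IsNearStationary P (MNN.manifoldRisk d M ρ X loss Y) ε (W j)) →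
            MNN.StepCondition P (MNN.manifoldRisk d M ρ X loss Y) J Δt ε W k) →
          ∃ k : ℕ, (k : ℝ) ≤ C / ε ^ 2 ∧
            MNN.IsNearStationary P (MNN.manifoldRisk d M ρ X loss Y) ε (W k)) ∧
        ((∀ k, (∀ j ≤ k, ¬ MNN.IsNearMinimal P (MNN.manifoldRisk d M ρ X loss Y) ε (W j)) →
            MNN.StepCondition P (MNN.manifoldRisk d M ρ X loss Y) J Δt ε W k) →
          ∃ k : ℕ, (k : ℝ) ≤ C / ε ^ 2 ∧
            MNN.IsNearMinimal P (MNN.manifoldRisk d M ρ X loss Y) ε (W k)) := by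
  set f := MNN.manifoldRisk d M ρ X loss Y with hf
  have hf0 : ∀ V, 0 ≤ f V := fun V => integral_nonneg fun u => hloss.nonneg _ _
  -- The budget `f W₀` divided by the decrease `η₀ε²/2` of one accurate step is this constant over
  -- `ε²`.
  refine ⟨2 * f W₀ / η₀, fun ε hε Ω _ P _ n hn σ _ u hu T _ hT Δt _ η hη hη' J hJ W hW hWS => ?_⟩
  have : IsProbabilityMeasure (MNN.uniformMeasure d M) := by
    -- The uniform measure is the law of a node, hence a probability measure; `1 ≤ n 0` provides the
    -- node.
    rw [← hu.law 0 ⟨0, hn 0⟩]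
    exact Measure.isProbabilityMeasure_map (hu.measurable 0 ⟨0, hn 0⟩).aemeasurable
  have hJm : ∀ t, Measurable (Function.uncurry (J t)) := fun t => by
    rw [hJ]
    exact measurable_graphLoss hloss.measurable ρ hX hY (σ t) (hu.measurable t) (hT t)
  have hJd : ∀ t ω, Differentiable ℝ (J t ω) := fun t ω => by
    rw [hJ]
    exact differentiable_graphLoss hloss.differentiable ρ X Y (σ t) _ _
  have hWm : ∀ k, Measurable (W k) := fun k => by
    rw [hW]
    exact measurable_iterates hJm hJd η Δt W₀ k
  have hW0 : ∀ ω, W 0 ω = W₀ := fun ω => by rw [hW]; rfl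
  have hWs : ∀ k ω, W (k + 1) ω = W k ω - η k • ∇ (J (k / Δt) ω) (W k ω) := fun k ω => by
    rw [hW]; rfl
  have hdec : ∀ᵐ ω ∂P, ∀ k, ‖∇ f (W k ω) - ∇ (J (k / Δt) ω) (W k ω)‖ < ‖∇ f (W k ω)‖ - ε →
      f (W (k + 1) ω) ≤ f (W k ω) - η₀ * ε ^ 2 / 2 := by
    filter_upwards [ae_all_iff.2 hWS] with ω hω k he
    have hk := hω (k + 1)
    rw [hWs] at hk ⊢
    exact manifoldRisk_le_sub X hY ρ hloss hrisk hS hdiff hα hβ hη₀ (hη k) (hη' k) hε (hω k) hk he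
  -- One step beyond the floor makes the total decrease strictly exceed `f W₀`, while every index
  -- below that number is still at most `C / ε²`.
  have hN : f W₀ < ((⌊2 * f W₀ / η₀ / ε ^ 2⌋₊ + 1 : ℕ) : ℝ) * (η₀ * ε ^ 2 / 2) := by
    have h := Nat.lt_floor_add_one (2 * f W₀ / η₀ / ε ^ 2)
    rw [div_div, div_lt_iff₀ (by positivity)] at h
    rw [← div_div] at h
    push_cast
    linarith
  obtain ⟨k, hk, hcond⟩ :=
    exists_not_stepCondition hf0 (fun k => hη₀.trans_le (hη k)) hWm hW0 hWs hdec hN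
  have hC : ∀ j ≤ k, (j : ℝ) ≤ 2 * f W₀ / η₀ / ε ^ 2 := fun j hj =>
    (Nat.le_floor_iff (div_nonneg (div_nonneg (mul_nonneg zero_le_two (hf0 _)) hη₀.le)
      (sq_nonneg ε))).1 (hj.trans (Nat.lt_succ_iff.1 hk))
  constructor
  -- If no iterate within the bound were in the neighborhood, the hypothesis would give the
  -- condition at the step `k` where it fails.
  all_goals
    intro h
    by_contra! hno
    exact hcond (h k fun j hj => hno j (hC j hj))
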